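/- Theorem (Existence of the unitary transformation). Let $\hbar>0$, let $\sigma_x=\begin{pmatrix}0&1\\1&0\end{pmatrix}$, $\sigma_z=\begin{pmatrix}1&0\\0&-1\end{pmatrix}$, and for real numbers $u=(\kappa_A,\kappa_B,\epsilon_A,\epsilon_B,\zeta,\nu)\in\mathbb{R}^6$ put $$H(u)=\kappa_A\,\sigma_x\otimes\mathbb 1+\kappa_B\,\mathbb 1\otimes\sigma_x+\epsilon_A\,\sigma_z\otimes\mathbb 1+\epsilon_B\,\mathbb 1\otimes\sigma_z+\zeta\,\sigma_z\otimes\sigma_z+\nu\,\sigma_x\otimes\sigma_x .$$ The two-qubit control system $$\rho'(t)=\frac{1}{i\hbar}\,[H(u(t)),\rho(t)]$$ is density matrix controllable: for any two density matrices $\rho_i,\rho_f\in\mathbb{C}^{4\times4}$ (positive semidefinite with trace one) that are unitarily equivalent, i.e. $\rho_f=U\rho_iU^\dagger$ for some unitary $U$, there exist a time $T>0$ and continuous real control functions $u=(\kappa_A,\kappa_B,\epsilon_A,\epsilon_B,\zeta,\nu):[0,T]\to\mathbb{R}^6$ such that the solution $\rho$ of the equation on $[0,T]$ with $\rho(0)=\rho_i$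 satisfies $\rho(T)=\rho_f$. -/

import Mathlib

open scoped Matrix Kronecker ComplexOrder

namespace QuantumControl

/-- The Pauli matrix `σ_x`. -/
def pauliX : Matrix (Fin 2) (Fin 2) ℂ := !![0, 1; 1, 0]

/-- The Pauli matrix `σ_z`. -/
def pauliZ : Matrix (Fin 2) (Fin 2) ℂ := !![1, 0; 0, -1]

/-- The two-qubit Hamiltonian with real control values
`u = (κ_A, κ_B, ε_A, ε_B, ζ, ν)`; the basis of the two-qubit space is indexed by
`Fin 2 × Fin 2`. -/
def twoQubitHamiltonian (u : Fin 6 → ℝ) : Matrix (Fin 2 × Fin 2) (Fin 2 × Fin 2) ℂ :=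
  (u 0 : ℂ) • (pauliX ⊗ₖ (1 : Matrix (Fin 2) (Fin 2) ℂ))
    + (u 1 : ℂ) • ((1 : Matrix (Fin 2) (Fin 2) ℂ) ⊗ₖ pauliX)
    + (u 2 : ℂ) • (pauliZ ⊗ₖ (1 : Matrix (Fin 2) (Fin 2) ℂ))
    + (u 3 : ℂ) • ((1 : Matrix (Fin 2) (Fin 2) ℂ) ⊗ₖ pauliZ)
    + (u 4 : ℂ) • (pauliZ ⊗ₖ pauliZ)
    + (u 5 : ℂ) • (pauliX ⊗ₖ pauliX)

/-- A density matrix: positive semidefinite (in particular Hermitian) of trace one. -/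
def IsDensityMatrix {n : Type*} [Fintype n] (ρ : Matrix n n ℂ) : Prop :=
  ρ.PosSemidef ∧ ρ.trace = 1

/-- `B = U A U†` for some unitary matrix `U`. -/
def UnitarilyEquivalent {n : Type*} [Fintype n] [DecidableEq n] (A B : Matrix n n ℂ) : Prop :=
  ∃ U ∈ Matrix.unitaryGroup n ℂ, B = U * A * Uᴴ

/-- `ρ` solves the Liouville-von Neumann equation `dρ/dt = (1/(iℏ)) [H(t), ρ]` at every time of
the interval `[0, T]` (with one-sided derivatives at the end points). -/
def SolvesLiouville {n : Type*} [Fintype n] (hbar T : ℝ)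
    (H ρ : ℝ → Matrix n n ℂ) : Prop :=
  ∀ t ∈ Set.Icc (0 : ℝ) T,
    HasDerivWithinAt ρ ((1 / (Complex.I * (hbar : ℂ))) • (H t * ρ t - ρ t * H t))
      (Set.Icc (0 : ℝ) T) t

/-- Density matrix controllability of the system `dρ/dt = (1/(iℏ)) [H(u(t)), ρ]` with `m` real
controls: for any two unitarily equivalent density matrices `ρi`, `ρf` there are a time `T > 0`
and continuous real control functions `u` on `[0, T]` such that the solution starting from `ρi`
at time `0` is `ρf` at time `T`. -/
def DensityMatrixControllable {n : Type*} [Fintype n] [DecidableEq n] {m : ℕ} (hbar : ℝ)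
    (H : (Fin m → ℝ) → Matrix n n ℂ) : Prop :=
  ∀ ρi ρf : Matrix n n ℂ, IsDensityMatrix ρi → IsDensityMatrix ρf → UnitarilyEquivalent ρi ρf →
    ∃ (T : ℝ) (u : ℝ → Fin m → ℝ) (ρ : ℝ → Matrix n n ℂ),
      0 < T ∧ ContinuousOn u (Set.Icc 0 T) ∧ SolvesLiouville hbar T (fun t => H (u t)) ρ ∧
        ρ 0 = ρi ∧ ρ T = ρf

end QuantumControl

/-! Only the unitaries `U` that can be realised as `ρ₀ ↦ U ρ₀ U†` matter. If every control pulse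
starts and ends at zero, pulses can be concatenated continuously, so these `U` form a monoid
(`steerable`). It contains the scalar phases, which leave every state fixed.

A pulse in a single control, with generator `P² = 1`, yields every `exp(-isP)`
(`rotor_mem_steerable`). Conjugation by a quarter turn plays the role of the commutator: from
anticommuting `P` and `Q` it yields the rotations generated by `PQ` (`rotor_mul_mem`). Products of
these exponentials isolate single basis vectors and coordinate planes: the diagonal generators give
single-coordinate phases, and pairs of real antisymmetric generators give Givens rotations. Gaussian
elimination by unitaries then shows that the monoid contains the whole unitary group
(`unitaryGroup_le_of_phases_of_rotations`). -/

namespace QuantumControl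

/-! ### Reduction of a unitary by phases and Givens rotations -/

section Elimination

variable {n : Type*} [Fintype n] [DecidableEq n]

/-- `G` contains every unitary that multiplies a single coordinate by a phase. -/
def HasPhases (G : Submonoid (Matrix n n ℂ)) : Prop :=
  ∀ (k : n) (θ : ℝ), ∃ g ∈ G, ∀ v : n → ℂ,
    g *ᵥ v = Function.update v k (Complex.exp (θ * Complex.I) * v k)

/-- `G` contains every Givens rotation. -/
def HasRotations (G : Submonoid (Matrix n n ℂ)) : Prop :=
  ∀ (k j : n), k ≠ j → ∀ θ : ℝ, ∃ g ∈ G, ∀ v : n → ℂ,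
    g *ᵥ v = Function.update (Function.update v k (Real.cos θ * v k + Real.sin θ * v j)) j
      (-Real.sin θ * v k + Real.cos θ * v j)

lemma exp_neg_arg_mul_self (z : ℂ) :
    Complex.exp ((-z.arg : ℝ) * Complex.I) * z = (‖z‖ : ℂ) := by
  conv_lhs => rw [← Complex.norm_mul_exp_arg_mul_I z]
  rw [mul_left_comm, ← Complex.exp_add]
  simp

lemma exists_rotation_angle (a b : ℝ) : ∃ θ : ℝ, -Real.sin θ * a + Real.cos θ * b = 0 := by
  set z : ℂ := ⟨a, b⟩
  refine ⟨z.arg, ?_⟩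
  have ha : ‖z‖ * Real.cos z.arg = a := Complex.norm_mul_cos_arg z
  have hb : ‖z‖ * Real.sin z.arg = b := Complex.norm_mul_sin_arg z
  linear_combination Real.sin z.arg * ha - Real.cos z.arg * hb

lemma exists_phase_eq_norm {G : Submonoid (Matrix n n ℂ)} (hp : HasPhases G) (k : n)
    (v : n → ℂ) : ∃ g ∈ G, g *ᵥ v = Function.update v k (‖v k‖ : ℂ) ∧
      ∀ w : n → ℂ, w k = 0 → g *ᵥ w = w := by
  obtain ⟨g, hg, h⟩ := hp k (-(v k).arg)
  refine ⟨g, hg, by rw [h, exp_neg_arg_mul_self], fun w hw => ?_⟩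
  rw [h, hw, mul_zero, ← hw, Function.update_eq_self]

/-- Phases first make both entries real and nonnegative; a real rotation can then kill the second.
The last clause protects columns that are already reduced. -/
lemma exists_annihilate {G : Submonoid (Matrix n n ℂ)} (hp : HasPhases G) (hr : HasRotations G)
    {k j : n} (hkj : k ≠ j) (v : n → ℂ) :
    ∃ g ∈ G, (g *ᵥ v) j = 0 ∧ (∀ i, i ≠ k → i ≠ j → (g *ᵥ v) i = v i) ∧
      ∀ w : n → ℂ, w k = 0 → w j = 0 → g *ᵥ w = w := by
  obtain ⟨g₁, hg₁, h₁, f₁⟩ := exists_phase_eq_norm hp k v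
  obtain ⟨g₂, hg₂, h₂, f₂⟩ := exists_phase_eq_norm hp j (g₁ *ᵥ v)
  obtain ⟨θ, hθ⟩ := exists_rotation_angle ‖v k‖ ‖v j‖
  obtain ⟨g₃, hg₃, h₃⟩ := hr k j hkj θ
  have hθ' : -(Real.sin θ : ℂ) * (‖v k‖ : ℂ) + (Real.cos θ : ℂ) * (‖v j‖ : ℂ) = 0 := by
    exact_mod_cast hθ
  refine ⟨g₃ * (g₂ * g₁), mul_mem hg₃ (mul_mem hg₂ hg₁), ?_, fun i hk hj => ?_, fun w hk hj => ?_⟩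
  · rw [← Matrix.mulVec_mulVec, ← Matrix.mulVec_mulVec, h₃, h₂, h₁]
    simpa [Function.update_of_ne hkj, Function.update_of_ne hkj.symm] using hθ'
  · rw [← Matrix.mulVec_mulVec, ← Matrix.mulVec_mulVec, h₃, h₂, h₁]
    simp [Function.update_of_ne hk, Function.update_of_ne hj]
  · rw [← Matrix.mulVec_mulVec, ← Matrix.mulVec_mulVec, f₁ w hk, f₂ w hj, h₃, hk, hj]
    ext i
    by_cases hij : i = j
    · subst hij; simp [hj]
    · by_cases hik : i = k
      · subst hik; simp [hk, hij]
      · simp [hij, hik]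

lemma exists_mulVec_eq_single {G : Submonoid (Matrix n n ℂ)} (hp : HasPhases G)
    (hr : HasRotations G) (k : n) (J : Finset n) (hk : k ∉ J) (v : n → ℂ)
    (hv : ∀ i, i ≠ k → i ∉ J → v i = 0) :
    ∃ g ∈ G, (∃ r : ℝ, 0 ≤ r ∧ g *ᵥ v = Pi.single k (r : ℂ)) ∧
      ∀ w : n → ℂ, w k = 0 → (∀ i ∈ J, w i = 0) → g *ᵥ w = w := by
  induction J using Finset.induction_on generalizing v with
  | empty =>
    obtain ⟨g, hg, h, f⟩ := exists_phase_eq_norm hp k v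
    refine ⟨g, hg, ⟨‖v k‖, norm_nonneg _, ?_⟩, fun w hw _ => f w hw⟩
    rw [h]
    ext i
    by_cases hik : i = k
    · subst hik; simp
    · simp [hik, hv i hik]
  | insert j J hj ih =>
    have hkj : k ≠ j := fun h => hk (h ▸ Finset.mem_insert_self _ _)
    obtain ⟨g, hg, h0, h1, f⟩ := exists_annihilate hp hr hkj v
    obtain ⟨g', hg', ⟨r, hr0, hgr⟩, f'⟩ := ih (fun h => hk (Finset.mem_insert_of_mem h)) (g *ᵥ v)
      (fun i hik hiJ => by
        by_cases hij : i = j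
        · rw [hij, h0]
        · rw [h1 i hik hij]; exact hv i hik (by simp [hij, hiJ]))
    refine ⟨g' * g, mul_mem hg' hg, ⟨r, hr0, by rw [← Matrix.mulVec_mulVec, hgr]⟩,
      fun w hw hJ => ?_⟩
    rw [← Matrix.mulVec_mulVec, f w hw (hJ j (Finset.mem_insert_self _ _)),
      f' w hw fun i hi => hJ i (Finset.mem_insert_of_mem hi)]

lemma star_mulVec_dotProduct_mulVec {U : Matrix n n ℂ} (hU : U ∈ Matrix.unitaryGroup n ℂ)
    (v w : n → ℂ) : star (U *ᵥ v) ⬝ᵥ (U *ᵥ w) = star v ⬝ᵥ w := by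
  have h : Uᴴ * U = 1 := Matrix.mem_unitaryGroup_iff'.1 hU
  rw [Matrix.star_mulVec, ← Matrix.dotProduct_mulVec, Matrix.mulVec_mulVec, h, Matrix.one_mulVec]

lemma exists_mul_fixes_columns {G : Submonoid (Matrix n n ℂ)} (hG : G ≤ Matrix.unitaryGroup n ℂ)
    (hp : HasPhases G) (hr : HasRotations G) {U : Matrix n n ℂ}
    (hU : U ∈ Matrix.unitaryGroup n ℂ) (S : Finset n) :
    ∃ g ∈ G, ∀ i ∈ S, (g * U) *ᵥ Pi.single i 1 = Pi.single i 1 := by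
  induction S using Finset.induction_on with
  | empty => exact ⟨1, one_mem _, by simp⟩
  | insert k S hk ih =>
    obtain ⟨g, hg, h⟩ := ih
    have hgU : g * U ∈ Matrix.unitaryGroup n ℂ := mul_mem (hG hg) hU
    set v := (g * U) *ᵥ Pi.single k 1 with hvdef
    -- Column `k` is orthogonal to the columns already reduced to basis vectors, so only coordinates
    -- outside `S` need eliminating.
    have hv : ∀ i ∈ S, v i = 0 := fun i hi => by
      have := star_mulVec_dotProduct_mulVec hgU (Pi.single i 1) (Pi.single k 1)
      rw [h i hi, ← hvdef] at this
      have hik : i ≠ k := fun e => hk (e ▸ hi)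
      simpa [← Pi.single_star, hik] using this
    obtain ⟨g', hg', ⟨r, hr0, hgr⟩, f⟩ := exists_mulVec_eq_single hp hr k (insert k S)ᶜ (by simp) v
      (fun i hik hi => hv i (by simpa [hik] using hi))
    -- Unitarity gives `r² = 1`; the sign condition on `r` excludes `-1`.
    have hr1 : r = 1 := by
      have h1 := star_mulVec_dotProduct_mulVec (hG hg') v v
      have h2 := star_mulVec_dotProduct_mulVec hgU (Pi.single k 1) (Pi.single k 1)
      rw [← hvdef] at h2
      rw [h2, hgr] at h1
      simp at h1
      have h3 : r * r = 1 := by exact_mod_cast h1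
      nlinarith
    refine ⟨g' * g, mul_mem hg' hg, fun i hi => ?_⟩
    rw [mul_assoc, ← Matrix.mulVec_mulVec]
    rcases Finset.mem_insert.1 hi with rfl | hiS
    · rw [← hvdef, hgr, hr1, Complex.ofReal_one]
    · have hik : i ≠ k := fun e => hk (e ▸ hiS)
      rw [h i hiS]
      refine f _ (by simp [hik.symm]) fun l hl => ?_
      have : l ≠ i := fun e => by subst e; simp [hiS] at hl
      simp [this]

/-- Single-coordinate phases and Givens rotations generate the unitary group. -/
theorem unitaryGroup_le_of_phases_of_rotations {G : Submonoid (Matrix n n ℂ)}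
    (hG : G ≤ Matrix.unitaryGroup n ℂ) (hp : HasPhases G) (hr : HasRotations G) :
    Matrix.unitaryGroup n ℂ ≤ G := by
  intro U hU
  -- Reducing `U†` rather than `U` makes the reducing element equal to `U` itself, so `G` need not
  -- be closed under inverses.
  obtain ⟨g, hg, h⟩ := exists_mul_fixes_columns hG hp hr (Unitary.star_mem hU) Finset.univ
  have h1 : g * star U = 1 := by
    refine Matrix.ext_of_mulVec_single fun i => ?_
    rw [h i (Finset.mem_univ i), Matrix.one_mulVec]
  have : g = U := by
    rw [← mul_one g, ← Matrix.mem_unitaryGroup_iff'.1 hU, ← mul_assoc, h1, one_mul]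
  exact this ▸ hg

end Elimination
-- Steering by concatenated pulses
section Steering

variable {n : Type*} [Fintype n] [DecidableEq n] {m : ℕ}

lemma hasDerivAt_matrix_iff {n : Type*} [Finite n] {ρ : ℝ → Matrix n n ℂ} {ρ' : Matrix n n ℂ} {t : ℝ} :
    HasDerivAt ρ ρ' t ↔ ∀ i j, HasDerivAt (fun t => ρ t i j) (ρ' i j) t := by
  have := Fintype.ofFinite n
  exact Iff.trans (hasDerivAt_pi (E' := fun _ : n => n → ℂ)) (forall_congr' fun _ => hasDerivAt_pi)

/-- The matrices `U` such that every initial state `ρ₀` is steered to `U ρ₀ U†` by controls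
vanishing outside a bounded time interval. -/
def steerable (hbar : ℝ) (H : (Fin m → ℝ) → Matrix n n ℂ) (hH : H 0 = 0) :
    Submonoid (Matrix n n ℂ) where
  carrier := {U | ∀ ρ₀ : Matrix n n ℂ, ∃ (T : ℝ) (u : ℝ → Fin m → ℝ) (ρ : ℝ → Matrix n n ℂ),
    0 < T ∧ Continuous u ∧
    (∀ t, HasDerivAt ρ
      ((1 / (Complex.I * (hbar : ℂ))) • (H (u t) * ρ t - ρ t * H (u t))) t) ∧
    (∀ t ≤ 0, u t = 0 ∧ ρ t = ρ₀) ∧ ∀ t, T ≤ t → u t = 0 ∧ ρ t = U * ρ₀ * Uᴴ}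
  one_mem' := fun ρ₀ => ⟨1, fun _ => 0, fun _ => ρ₀, one_pos, continuous_const,
    fun t => hasDerivAt_matrix_iff.2 fun i j => by simpa [hH] using hasDerivAt_const t (ρ₀ i j), by simp, by simp⟩
  mul_mem' := by
    intro U V hU hV ρ₀
    obtain ⟨T₁, u₁, ρ₁, hT₁, hu₁, hd₁, ha₁, hb₁⟩ := hV ρ₀
    obtain ⟨T₂, u₂, ρ₂, hT₂, hu₂, hd₂, ha₂, hb₂⟩ := hU (V * ρ₀ * Vᴴ)
    -- At every time one of the two pulses is off and its trajectory equals the intermediate state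
    -- `V ρ₀ V†`. Subtracting that state leaves the active trajectory.
    refine ⟨T₁ + T₂, fun t => u₁ t + u₂ (t - T₁),
      fun t => ρ₁ t + ρ₂ (t - T₁) - V * ρ₀ * Vᴴ, by positivity, by fun_prop, fun t => ?_,
      fun t ht => ?_, fun t ht => ?_⟩
    · refine hasDerivAt_matrix_iff.2 fun i j => (((hasDerivAt_matrix_iff.1 (hd₁ t) i j).add
        ((hasDerivAt_matrix_iff.1 (hd₂ (t - T₁)) i j).comp_sub_const t T₁)).sub_const
          ((V * ρ₀ * Vᴴ) i j)).congr_deriv ?_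
      rw [← Matrix.add_apply]
      rcases le_total t T₁ with ht | ht
      · obtain ⟨e, e'⟩ := ha₂ (t - T₁) (by linarith)
        simp [e, e', hH]
      · obtain ⟨e, e'⟩ := hb₁ t ht
        simp [e, e', hH]
    · obtain ⟨e, e'⟩ := ha₂ (t - T₁) (by linarith)
      obtain ⟨e₁, e₁'⟩ := ha₁ t ht
      simp [e, e', e₁, e₁']
    · obtain ⟨e, e'⟩ := hb₂ (t - T₁) (by linarith)
      obtain ⟨e₁, e₁'⟩ := hb₁ t (by linarith)
      simp [e, e', e₁, e₁', Matrix.mul_assoc]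

/-- Scalar phases do not move states. -/
lemma smul_one_mem_steerable {hbar : ℝ} {H : (Fin m → ℝ) → Matrix n n ℂ} (hH : H 0 = 0) (θ : ℝ) :
    Complex.exp (θ * Complex.I) • (1 : Matrix n n ℂ) ∈ steerable hbar H hH := by
  intro ρ₀
  have key : (Complex.exp (θ * Complex.I) • (1 : Matrix n n ℂ)) * ρ₀ *
      (Complex.exp (θ * Complex.I) • (1 : Matrix n n ℂ))ᴴ = ρ₀ := by
    simp [Matrix.conjTranspose_smul, smul_smul, ← Complex.exp_conj, ← Complex.exp_add]
  refine ⟨1, fun _ => 0, fun _ => ρ₀, one_pos, continuous_const,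
    fun t => hasDerivAt_matrix_iff.2 fun i j => by simpa [hH] using hasDerivAt_const t (ρ₀ i j), by simp, fun t _ => ⟨rfl, key.symm⟩⟩

/-- `exp (s K)` for a matrix `K` with `K ^ 2 = -1`. -/
noncomputable def rotor (K : Matrix n n ℂ) (s : ℝ) : Matrix n n ℂ :=
  (Real.cos s : ℂ) • 1 + (Real.sin s : ℂ) • K

lemma rotor_mem_unitaryGroup {K : Matrix n n ℂ} (hK : K * K = -1) (hK' : Kᴴ = -K) (s : ℝ) :
    rotor K s ∈ Matrix.unitaryGroup n ℂ := by
  rw [Matrix.mem_unitaryGroup_iff, Matrix.star_eq_conjTranspose]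
  have h : (Real.cos s : ℂ) * Real.cos s + Real.sin s * Real.sin s = 1 := by
    have := Real.cos_sq_add_sin_sq s
    rw [sq, sq] at this
    exact_mod_cast this
  have e : rotor K s * (rotor K s)ᴴ =
      ((Real.cos s : ℂ) * Real.cos s + Real.sin s * Real.sin s) • (1 : Matrix n n ℂ) := by
    simp only [rotor, Matrix.conjTranspose_add, Matrix.conjTranspose_smul, hK', mul_add, add_mul,
      Matrix.conjTranspose_one, smul_mul_smul_comm, mul_neg, one_mul, mul_one, hK, smul_neg,
      Complex.star_def, Complex.conj_ofReal]
    module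
  rw [e, h, one_smul]

/-- Such points are global minima, so the derivative vanishes at the junction `t = 0` too. -/
lemma deriv_smoothTransition_of_nonpos {t : ℝ} (ht : t ≤ 0) :
    deriv Real.smoothTransition t = 0 := by
  refine IsLocalMin.deriv_eq_zero (Filter.Eventually.of_forall fun x => ?_)
  rw [Real.smoothTransition.zero_of_nonpos ht]
  exact Real.smoothTransition.nonneg x

lemma deriv_smoothTransition_of_one_le {t : ℝ} (ht : 1 ≤ t) :
    deriv Real.smoothTransition t = 0 := by
  refine IsLocalMax.deriv_eq_zero (Filter.Eventually.of_forall fun x => ?_)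
  rw [Real.smoothTransition.one_of_one_le ht]
  exact Real.smoothTransition.le_one x

/-- The conjugate is a trigonometric polynomial in the angle with constant matrix coefficients; `K²
= -1` turns its derivative into the commutator with `K`. -/
lemma hasDerivAt_rotor_conj {K : Matrix n n ℂ} (hK : K * K = -1) (hK' : Kᴴ = -K)
    (ρ₀ : Matrix n n ℂ) {φ : ℝ → ℝ} {φ' t : ℝ} (hφ : HasDerivAt φ φ' t) :
    HasDerivAt (fun t => rotor K (φ t) * ρ₀ * (rotor K (φ t))ᴴ)
      ((φ' : ℂ) • (K * (rotor K (φ t) * ρ₀ * (rotor K (φ t))ᴴ) -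
        (rotor K (φ t) * ρ₀ * (rotor K (φ t))ᴴ) * K)) t := by
  have expand : ∀ s, rotor K s * ρ₀ * (rotor K s)ᴴ =
      (Real.cos s * Real.cos s) • ρ₀ + (Real.cos s * Real.sin s) • (K * ρ₀ - ρ₀ * K) -
        (Real.sin s * Real.sin s) • (K * ρ₀ * K) := by
    intro s
    simp only [rotor, Matrix.conjTranspose_add, Matrix.conjTranspose_smul, hK',
      Matrix.conjTranspose_one, Complex.star_def, Complex.conj_ofReal, mul_add, add_mul, smul_neg,
      smul_mul_assoc, mul_smul_comm, mul_neg, one_mul, mul_one, ← Complex.coe_smul]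
    push_cast
    module
  have hK₁ : ∀ A : Matrix n n ℂ, K * (K * A) = -A := fun A => by
    rw [← mul_assoc, hK, neg_mul, one_mul]
  have hK₂ : ∀ A : Matrix n n ℂ, A * K * K = -A := fun A => by
    rw [mul_assoc, hK, mul_neg, mul_one]
  simp only [expand]
  have hc := hφ.cos
  have hs := hφ.sin
  refine hasDerivAt_matrix_iff.2 fun i j => ((((hc.mul hc).smul_const (ρ₀ i j)).add
    ((hc.mul hs).smul_const ((K * ρ₀ - ρ₀ * K) i j))).sub
      ((hs.mul hs).smul_const ((K * ρ₀ * K) i j))).congr_deriv ?_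
  simp only [← Matrix.smul_apply, ← Matrix.add_apply, ← Matrix.sub_apply]
  refine congrArg (fun M : Matrix n n ℂ => M i j) ?_
  simp only [mul_add, add_mul, mul_sub, sub_mul, smul_mul_assoc, mul_smul_comm, mul_assoc K, hK₁,
    hK₂, mul_neg, ← Complex.coe_smul]
  push_cast
  module

lemma rotor_mem_steerable {hbar : ℝ} (hbar_pos : 0 < hbar) {H : (Fin m → ℝ) → Matrix n n ℂ}
    (hH : H 0 = 0) {P : Matrix n n ℂ} (hP : P * P = 1) (hP' : Pᴴ = P) (j : Fin m)
    (hj : ∀ x : ℝ, H (Pi.single j x) = (x : ℂ) • P) (s : ℝ) :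
    rotor (-Complex.I • P) s ∈ steerable hbar H hH := by
  set K := -Complex.I • P with hKdef
  have hK : K * K = -1 := by
    simp [hKdef, smul_smul, hP]
  have hK' : Kᴴ = -K := by
    simp [hKdef, Matrix.conjTranspose_smul, hP']
  intro ρ₀
  have hd : ∀ t, HasDerivAt (fun t => s * Real.smoothTransition t)
      (s * deriv Real.smoothTransition t) t := fun t =>
    (((Real.smoothTransition.contDiff (n := 1)).differentiable one_ne_zero t).hasDerivAt).const_mul s
  have hc : Continuous (deriv Real.smoothTransition) :=
    (Real.smoothTransition.contDiff (n := 1)).continuous_deriv le_rfl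
  -- The rotation angle climbs smoothly from `0` to `s`; the control is its speed, times `hbar` to
  -- cancel the equation's `1/ℏ`.
  refine ⟨1, fun t => Pi.single j (hbar * (s * deriv Real.smoothTransition t)),
    fun t => rotor K (s * Real.smoothTransition t) * ρ₀ * (rotor K (s * Real.smoothTransition t))ᴴ,
    one_pos, ?_, fun t => ?_, fun t ht => ⟨?_, ?_⟩, fun t ht => ⟨?_, ?_⟩⟩
  · exact (continuous_single j).comp (by fun_prop)
  · convert hasDerivAt_rotor_conj hK hK' ρ₀ (hd t) using 1
    have hb : (hbar : ℂ) ≠ 0 := by exact_mod_cast hbar_pos.ne'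
    simp only [hj, hKdef, smul_mul_assoc, mul_smul_comm, ← smul_sub, smul_smul]
    congr 1
    push_cast
    field_simp
    simp
  · simp [deriv_smoothTransition_of_nonpos ht]
  · simp [Real.smoothTransition.zero_of_nonpos ht, rotor]
  · simp [deriv_smoothTransition_of_one_le ht]
  · simp [Real.smoothTransition.one_of_one_le ht]

/-- Conjugating by a quarter turn of `K` turns the rotors of `L` into those of `K * L`. -/
lemma rotor_mul_mem {G : Submonoid (Matrix n n ℂ)} {K L : Matrix n n ℂ} (hK : K * K = -1)
    (hKL : L * K = -(K * L)) (hGK : ∀ s, rotor K s ∈ G) (hGL : ∀ s, rotor L s ∈ G) (s : ℝ) :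
    rotor (K * L) s ∈ G := by
  -- Anticommutation doubles the angle: conjugating `L` by `rotor K θ` gives `rotor K (2θ) * L`,
  -- which is `K * L` at `θ = π/4`.
  have e : rotor (K * L) s = rotor K (Real.pi / 4) * rotor L s * rotor K (-(Real.pi / 4)) := by
    have h2 : ((Real.sqrt 2 / 2 : ℝ) : ℂ) * ((Real.sqrt 2 / 2 : ℝ) : ℂ) = 1 / 2 := by
      have : (Real.sqrt 2 / 2) * (Real.sqrt 2 / 2) = (1 / 2 : ℝ) := by
        have := Real.mul_self_sqrt (show (0 : ℝ) ≤ 2 by norm_num)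
        linarith
      rw [← Complex.ofReal_mul, this]; norm_num
    simp only [rotor, Real.cos_neg, Real.sin_neg, Real.cos_pi_div_four, Real.sin_pi_div_four,
      Complex.ofReal_neg]
    generalize ((Real.sqrt 2 / 2 : ℝ) : ℂ) = a at h2
    have hKLK : K * L * K = L := by rw [mul_assoc, hKL, mul_neg, ← mul_assoc, hK]; simp
    simp only [mul_add, add_mul, smul_mul_assoc, mul_smul_comm, one_mul, mul_one, hK, hKL, hKLK,
      smul_add, smul_neg, neg_smul, smul_smul, mul_neg]
    match_scalars
    · linear_combination (-2 * Complex.cos s) * h2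
    · linear_combination (-2 * Complex.sin s) * h2
    all_goals ring
  rw [e]
  exact mul_mem (mul_mem (hGK _) (hGL _)) (hGK _)

end Steering
-- Pauli generators of the two-qubit system
/-- The real matrix `i σ_y`. -/
def pauliJ : Matrix (Fin 2) (Fin 2) ℂ := !![0, 1; -1, 0]

lemma pauliX_mul_self : pauliX * pauliX = 1 := by
  ext i j; fin_cases i <;> fin_cases j <;> simp [pauliX, Matrix.mul_apply]
lemma pauliZ_mul_self : pauliZ * pauliZ = 1 := by
  ext i j; fin_cases i <;> fin_cases j <;> simp [pauliZ, Matrix.mul_apply]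
lemma pauliZ_mul_pauliX : pauliZ * pauliX = pauliJ := by
  ext i j; fin_cases i <;> fin_cases j <;> simp [pauliX, pauliZ, pauliJ, Matrix.mul_apply]
lemma pauliX_mul_pauliZ : pauliX * pauliZ = -pauliJ := by
  ext i j; fin_cases i <;> fin_cases j <;> simp [pauliX, pauliZ, pauliJ, Matrix.mul_apply]
lemma conjTranspose_pauliX : pauliXᴴ = pauliX := by
  ext i j; fin_cases i <;> fin_cases j <;> simp [pauliX]
lemma conjTranspose_pauliZ : pauliZᴴ = pauliZ := by
  ext i j; fin_cases i <;> fin_cases j <;> simp [pauliZ]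

lemma neg_kronecker {l m n p : Type*} (A : Matrix l m ℂ) (B : Matrix n p ℂ) :
    (-A) ⊗ₖ B = -(A ⊗ₖ B) := by
  ext; simp
lemma kronecker_neg {l m n p : Type*} (A : Matrix l m ℂ) (B : Matrix n p ℂ) :
    A ⊗ₖ (-B) = -(A ⊗ₖ B) := by
  ext; simp

lemma kronecker_mul_self {A B : Matrix (Fin 2) (Fin 2) ℂ} (hA : A * A = 1) (hB : B * B = 1) :
    (A ⊗ₖ B) * (A ⊗ₖ B) = 1 := by
  rw [← Matrix.mul_kronecker_mul, hA, hB, Matrix.one_kronecker_one]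

lemma twoQubitHamiltonian_zero : twoQubitHamiltonian 0 = 0 := by
  simp [twoQubitHamiltonian]

/-- The unitaries attainable by the two-qubit system. -/
def attainable (hbar : ℝ) :
    Submonoid (Matrix (Fin 2 × Fin 2) (Fin 2 × Fin 2) ℂ) :=
  steerable hbar twoQubitHamiltonian twoQubitHamiltonian_zero ⊓ Matrix.unitaryGroup _ ℂ

lemma rotor_mem_attainable {hbar : ℝ} (h : 0 < hbar) (j : Fin 6)
    {A B : Matrix (Fin 2) (Fin 2) ℂ} (hA : A * A = 1) (hB : B * B = 1) (hA' : Aᴴ = A)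
    (hB' : Bᴴ = B) (hj : ∀ x : ℝ, twoQubitHamiltonian (Pi.single j x) = (x : ℂ) • (A ⊗ₖ B))
    (s : ℝ) : rotor (-Complex.I • (A ⊗ₖ B)) s ∈ attainable hbar := by
  have hP := kronecker_mul_self hA hB
  have hP' : (A ⊗ₖ B)ᴴ = A ⊗ₖ B := by rw [Matrix.conjTranspose_kronecker, hA', hB']
  exact ⟨rotor_mem_steerable h _ hP hP' j hj s,
    rotor_mem_unitaryGroup (by simp [smul_smul, hP])
      (by simp [Matrix.conjTranspose_smul, hP']) s⟩

lemma rotor_XI {hbar : ℝ} (h : 0 < hbar) (s : ℝ) :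
    rotor (-Complex.I • (pauliX ⊗ₖ 1)) s ∈ attainable hbar :=
  rotor_mem_attainable h 0 pauliX_mul_self (one_mul 1) conjTranspose_pauliX (by simp)
    (fun x => by simp [twoQubitHamiltonian]) s
lemma rotor_IX {hbar : ℝ} (h : 0 < hbar) (s : ℝ) :
    rotor (-Complex.I • (1 ⊗ₖ pauliX)) s ∈ attainable hbar :=
  rotor_mem_attainable h 1 (one_mul 1) pauliX_mul_self (by simp) conjTranspose_pauliX
    (fun x => by simp [twoQubitHamiltonian]) s
lemma rotor_ZI {hbar : ℝ} (h : 0 < hbar) (s : ℝ) :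
    rotor (-Complex.I • (pauliZ ⊗ₖ 1)) s ∈ attainable hbar :=
  rotor_mem_attainable h 2 pauliZ_mul_self (one_mul 1) conjTranspose_pauliZ (by simp)
    (fun x => by simp [twoQubitHamiltonian]) s
lemma rotor_IZ {hbar : ℝ} (h : 0 < hbar) (s : ℝ) :
    rotor (-Complex.I • (1 ⊗ₖ pauliZ)) s ∈ attainable hbar :=
  rotor_mem_attainable h 3 (one_mul 1) pauliZ_mul_self (by simp) conjTranspose_pauliZ
    (fun x => by simp [twoQubitHamiltonian]) s
lemma rotor_ZZ {hbar : ℝ} (h : 0 < hbar) (s : ℝ) :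
    rotor (-Complex.I • (pauliZ ⊗ₖ pauliZ)) s ∈ attainable hbar :=
  rotor_mem_attainable h 4 pauliZ_mul_self pauliZ_mul_self conjTranspose_pauliZ
    conjTranspose_pauliZ (fun x => by simp [twoQubitHamiltonian]) s
lemma rotor_XX {hbar : ℝ} (h : 0 < hbar) (s : ℝ) :
    rotor (-Complex.I • (pauliX ⊗ₖ pauliX)) s ∈ attainable hbar :=
  rotor_mem_attainable h 5 pauliX_mul_self pauliX_mul_self conjTranspose_pauliX
    conjTranspose_pauliX (fun x => by simp [twoQubitHamiltonian]) s

/-- Anticommuting generators `-i P`, `-i Q` also generate the rotors of `-P Q`. -/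
lemma rotor_neg_mul_mem {n : Type*} [Fintype n] [DecidableEq n] {G : Submonoid (Matrix n n ℂ)}
    {P Q R : Matrix n n ℂ} (hP : P * P = 1) (hPQ : P * Q = R) (hQP : Q * P = -R)
    (hGP : ∀ s, rotor (-Complex.I • P) s ∈ G) (hGQ : ∀ s, rotor (-Complex.I • Q) s ∈ G) (s : ℝ) :
    rotor R s ∈ G := by
  -- The angle is `-s` because `(-iP)(-iQ) = -R`.
  have h := rotor_mul_mem (by simp [smul_smul, hP]) (by simp [smul_smul, hQP, hPQ]) hGP hGQ (-s)
  convert h using 1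
  simp [rotor, smul_smul, hPQ]

/-- This and the next five generators are real antisymmetric signed permutations; suitable pairs of
them isolate each coordinate plane. -/
lemma rotor_JI {hbar : ℝ} (h : 0 < hbar) (s : ℝ) : rotor (pauliJ ⊗ₖ 1) s ∈ attainable hbar := by
  refine rotor_neg_mul_mem (kronecker_mul_self pauliZ_mul_self (one_mul 1)) ?_ ?_
    (rotor_ZI h) (rotor_XI h) s <;>
  simp [← Matrix.mul_kronecker_mul, pauliZ_mul_pauliX, pauliX_mul_pauliZ, neg_kronecker]
lemma rotor_IJ {hbar : ℝ} (h : 0 < hbar) (s : ℝ) : rotor (1 ⊗ₖ pauliJ) s ∈ attainable hbar := by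
  refine rotor_neg_mul_mem (kronecker_mul_self (one_mul 1) pauliZ_mul_self) ?_ ?_
    (rotor_IZ h) (rotor_IX h) s <;>
  simp [← Matrix.mul_kronecker_mul, pauliZ_mul_pauliX, pauliX_mul_pauliZ, kronecker_neg]
lemma rotor_JZ {hbar : ℝ} (h : 0 < hbar) (s : ℝ) :
    rotor (pauliJ ⊗ₖ pauliZ) s ∈ attainable hbar := by
  refine rotor_neg_mul_mem (kronecker_mul_self pauliZ_mul_self pauliZ_mul_self) ?_ ?_
    (rotor_ZZ h) (rotor_XI h) s <;>
  simp [← Matrix.mul_kronecker_mul, pauliZ_mul_pauliX, pauliX_mul_pauliZ, neg_kronecker]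
lemma rotor_ZJ {hbar : ℝ} (h : 0 < hbar) (s : ℝ) :
    rotor (pauliZ ⊗ₖ pauliJ) s ∈ attainable hbar := by
  refine rotor_neg_mul_mem (kronecker_mul_self pauliZ_mul_self pauliZ_mul_self) ?_ ?_
    (rotor_ZZ h) (rotor_IX h) s <;>
  simp [← Matrix.mul_kronecker_mul, pauliZ_mul_pauliX, pauliX_mul_pauliZ, kronecker_neg]
lemma rotor_JX {hbar : ℝ} (h : 0 < hbar) (s : ℝ) :
    rotor (pauliJ ⊗ₖ pauliX) s ∈ attainable hbar := by
  refine rotor_neg_mul_mem (kronecker_mul_self pauliZ_mul_self (one_mul 1)) ?_ ?_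
    (rotor_ZI h) (rotor_XX h) s <;>
  simp [← Matrix.mul_kronecker_mul, pauliZ_mul_pauliX, pauliX_mul_pauliZ, neg_kronecker]
lemma rotor_XJ {hbar : ℝ} (h : 0 < hbar) (s : ℝ) :
    rotor (pauliX ⊗ₖ pauliJ) s ∈ attainable hbar := by
  refine rotor_neg_mul_mem (kronecker_mul_self (one_mul 1) pauliZ_mul_self) ?_ ?_
    (rotor_IZ h) (rotor_XX h) s <;>
  simp [← Matrix.mul_kronecker_mul, pauliZ_mul_pauliX, pauliX_mul_pauliZ, kronecker_neg]

lemma rotor_mulVec {n : Type*} [Fintype n] [DecidableEq n] (K : Matrix n n ℂ) (s : ℝ)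
    (v : n → ℂ) : rotor K s *ᵥ v = (Real.cos s : ℂ) • v + (Real.sin s : ℂ) • (K *ᵥ v) := by
  rw [rotor, Matrix.add_mulVec, Matrix.smul_mulVec, Matrix.smul_mulVec, Matrix.one_mulVec]

lemma kronecker_mulVec_apply (A B : Matrix (Fin 2) (Fin 2) ℂ) (v : Fin 2 × Fin 2 → ℂ)
    (p : Fin 2 × Fin 2) : ((A ⊗ₖ B) *ᵥ v) p =
      A p.1 0 * B p.2 0 * v (0, 0) + A p.1 0 * B p.2 1 * v (0, 1) +
        (A p.1 1 * B p.2 0 * v (1, 0) + A p.1 1 * B p.2 1 * v (1, 1)) := by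
  simp [Matrix.mulVec, dotProduct, Fintype.sum_prod_type]

/-! ### Single-coordinate phases -/

lemma rotor_diagonal {n : Type*} [Fintype n] [DecidableEq n] {d : n → ℝ}
    (hd : ∀ i, d i = 1 ∨ d i = -1) (s : ℝ) :
    rotor (-Complex.I • Matrix.diagonal fun i => (d i : ℂ)) s =
      Matrix.diagonal fun i => Complex.exp ((-(s * d i) : ℝ) * Complex.I) := by
  rw [rotor, ← Matrix.diagonal_one, ← Matrix.diagonal_smul, ← Matrix.diagonal_smul,
    ← Matrix.diagonal_smul, Matrix.diagonal_add]
  congr 1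
  ext i
  rw [Complex.exp_mul_I, ← Complex.ofReal_cos, ← Complex.ofReal_sin]
  rcases hd i with h | h <;> simp [h, mul_comm]

/-- The eigenvalue of `σ_z` on a basis state. -/
def spin (a : Fin 2) : ℝ := if a = 0 then 1 else -1

lemma spin_eq (a : Fin 2) : spin a = 1 ∨ spin a = -1 := by
  unfold spin; split_ifs <;> simp

lemma pauliZ_eq_diagonal : pauliZ = Matrix.diagonal fun a => (spin a : ℂ) := by
  ext i j; fin_cases i <;> fin_cases j <;> simp [pauliZ, spin]

lemma smul_one_mem_attainable (hbar θ : ℝ) :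
    Complex.exp (θ * Complex.I) • 1 ∈ attainable hbar := by
  refine ⟨smul_one_mem_steerable _ _, ?_⟩
  rw [SetLike.mem_coe, Matrix.mem_unitaryGroup_iff]
  simp [smul_smul, ← Complex.exp_conj, ← Complex.exp_add]

/-- With `a`, `b` the spins of `k`, the projector onto the basis vector `k` is `(1 + a σ_z⊗1 + b
1⊗σ_z + ab σ_z⊗σ_z)/4`. Its exponential splits into four commuting factors, which explains the
angles `θ/4`. -/
lemma hasPhases_attainable {hbar : ℝ} (h : 0 < hbar) : HasPhases (attainable hbar) := by
  intro k θ
  have e₁ := rotor_ZI h (-(θ / 4 * spin k.1))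
  have e₂ := rotor_IZ h (-(θ / 4 * spin k.2))
  have e₃ := rotor_ZZ h (-(θ / 4 * (spin k.1 * spin k.2)))
  have e₀ := smul_one_mem_attainable hbar (θ / 4)
  have z₁ : pauliZ ⊗ₖ (1 : Matrix (Fin 2) (Fin 2) ℂ) =
      Matrix.diagonal fun p : Fin 2 × Fin 2 => (spin p.1 : ℂ) := by
    rw [pauliZ_eq_diagonal, ← Matrix.diagonal_one, Matrix.diagonal_kronecker_diagonal]; simp
  have z₂ : (1 : Matrix (Fin 2) (Fin 2) ℂ) ⊗ₖ pauliZ =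
      Matrix.diagonal fun p : Fin 2 × Fin 2 => (spin p.2 : ℂ) := by
    rw [pauliZ_eq_diagonal, ← Matrix.diagonal_one, Matrix.diagonal_kronecker_diagonal]; simp
  have z₃ : pauliZ ⊗ₖ pauliZ =
      Matrix.diagonal fun p : Fin 2 × Fin 2 => ((spin p.1 * spin p.2 : ℝ) : ℂ) := by
    rw [pauliZ_eq_diagonal, Matrix.diagonal_kronecker_diagonal]; simp
  rw [z₁, rotor_diagonal fun p => spin_eq p.1] at e₁
  rw [z₂, rotor_diagonal fun p => spin_eq p.2] at e₂
  rw [z₃, rotor_diagonal fun p => by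
    rcases spin_eq p.1 with h | h <;> rcases spin_eq p.2 with h' | h' <;> simp [h, h']] at e₃
  refine ⟨_, mul_mem (mul_mem (mul_mem e₀ e₁) e₂) e₃, fun v => ?_⟩
  ext p
  rw [smul_one_mul, smul_mul_assoc, smul_mul_assoc, Matrix.diagonal_mul_diagonal,
    Matrix.diagonal_mul_diagonal, Matrix.smul_mulVec, Pi.smul_apply, Matrix.mulVec_diagonal,
    smul_eq_mul, ← mul_assoc, ← Complex.exp_add, ← Complex.exp_add, ← Complex.exp_add,
    ← add_mul, ← add_mul, ← add_mul, ← Complex.ofReal_add, ← Complex.ofReal_add,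
    ← Complex.ofReal_add]
  obtain ⟨a, b⟩ := k
  obtain ⟨c, d⟩ := p
  fin_cases a <;> fin_cases b <;> fin_cases c <;> fin_cases d <;>
    simp [spin] <;> left <;> ring_nf

/-! ### Givens rotations in the six coordinate planes -/

/-- `G` contains the Givens rotations in the plane of the coordinates `k`, `j`. -/
def HasRotation {n : Type*} [Fintype n] [DecidableEq n] (G : Submonoid (Matrix n n ℂ))
    (k j : n) : Prop :=
  ∀ θ : ℝ, ∃ g ∈ G, ∀ v : n → ℂ,
    g *ᵥ v = Function.update (Function.update v k (Real.cos θ * v k + Real.sin θ * v j)) j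
      (-Real.sin θ * v k + Real.cos θ * v j)

lemma HasRotation.symm {n : Type*} [Fintype n] [DecidableEq n] {G : Submonoid (Matrix n n ℂ)}
    {k j : n} (hkj : k ≠ j) (h : HasRotation G k j) : HasRotation G j k := by
  intro θ
  obtain ⟨g, hg, hv⟩ := h (-θ)
  refine ⟨g, hg, fun v => ?_⟩
  rw [hv, Function.update_comm hkj]
  simp only [Real.cos_neg, Real.sin_neg, Complex.ofReal_neg, neg_neg]
  congr 1
  · congr 1; ring
  · ring

lemma double_angle_complex (t : ℝ) :
    (Real.cos (2 * t) : ℂ) = Real.cos t * Real.cos t - Real.sin t * Real.sin t ∧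
    (Real.sin (2 * t) : ℂ) = 2 * Real.sin t * Real.cos t ∧
    (Real.cos t : ℂ) * Real.cos t + Real.sin t * Real.sin t = 1 := by
  refine ⟨?_, ?_, ?_⟩
  · rw [Real.cos_two_mul']; push_cast; ring
  · rw [Real.sin_two_mul]; push_cast; ring
  · have := Real.cos_sq_add_sin_sq t
    rw [sq, sq] at this
    exact_mod_cast this

/-- Two generators that agree up to the sign `ε` on the plane of the coordinates `k`, `j`, and up to
the sign `-ε` elsewhere, together rotate that plane only. -/
lemma hasRotation_of_rotors {G : Submonoid (Matrix (Fin 2 × Fin 2) (Fin 2 × Fin 2) ℂ)}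
    {K L : Matrix (Fin 2 × Fin 2) (Fin 2 × Fin 2) ℂ} (hK : ∀ s, rotor K s ∈ G)
    (hL : ∀ s, rotor L s ∈ G) {ε : ℝ} (hε : ε = 1 ∨ ε = -1) {k j : Fin 2 × Fin 2} (hkj : k ≠ j)
    (hk : ∀ v : Fin 2 × Fin 2 → ℂ, (K *ᵥ v) k = v j ∧ (L *ᵥ v) k = ε * v j)
    (hj : ∀ v : Fin 2 × Fin 2 → ℂ, (K *ᵥ v) j = -v k ∧ (L *ᵥ v) j = -(ε * v k))
    (hi : ∀ i, i ≠ k → i ≠ j → ∀ v : Fin 2 × Fin 2 → ℂ,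
      (L *ᵥ v) i = -(ε * (K *ᵥ v) i) ∧ (K *ᵥ (L *ᵥ v)) i = ε * v i) : HasRotation G k j := by
  intro θ
  -- Within the plane the two half-angle rotations add up to `θ`; elsewhere they are mutually
  -- inverse and cancel.
  refine ⟨rotor K (θ / 2) * rotor L (ε * (θ / 2)), mul_mem (hK _) (hL _), fun v => ?_⟩
  obtain ⟨h₁, h₂, h₃⟩ := double_angle_complex (θ / 2)
  rw [mul_div_cancel₀ θ two_ne_zero] at h₁ h₂
  have hcos : (Real.cos (ε * (θ / 2)) : ℂ) = Real.cos (θ / 2) := by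
    rcases hε with rfl | rfl <;> simp
  have hsin : (Real.sin (ε * (θ / 2)) : ℂ) = ε * Real.sin (θ / 2) := by
    rcases hε with rfl | rfl <;> simp
  have hε₂ : (ε : ℂ) * ε = 1 := by
    rcases hε with rfl | rfl <;> simp
  rw [h₁, h₂, ← Matrix.mulVec_mulVec, rotor_mulVec, rotor_mulVec, hcos, hsin]
  generalize (Real.cos (θ / 2) : ℂ) = c at *
  generalize (Real.sin (θ / 2) : ℂ) = s at *
  ext i
  by_cases hij : i = j
  · subst hij
    simp only [Matrix.mulVec_add, Matrix.mulVec_smul, Pi.add_apply, Pi.smul_apply, smul_eq_mul,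
      Function.update_self, (hj _).1, (hj _).2, (hk _).2]
    linear_combination (-(c * s * v k) - s * s * v i) * hε₂
  by_cases hik : i = k
  · subst hik
    simp only [Matrix.mulVec_add, Matrix.mulVec_smul, Pi.add_apply, Pi.smul_apply, smul_eq_mul,
      Function.update_self, Function.update_of_ne hkj, (hk _).1, (hk _).2, (hj _).2]
    linear_combination (c * s * v j - s * s * v i) * hε₂
  · simp only [Matrix.mulVec_add, Matrix.mulVec_smul, Pi.add_apply, Pi.smul_apply, smul_eq_mul,
      Function.update_of_ne hij, Function.update_of_ne hik, (hi i hik hij v).1,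
      (hi i hik hij v).2]
    linear_combination v i * h₃ + (s * s * v i - c * s * (K *ᵥ v) i) * hε₂

/-- The factor `σ_z` on the second qubit is the sign separating the planes with second bit `0` and
`1`; `ε` selects the plane. -/
lemma hasRotation_00_10 {hbar : ℝ} (h : 0 < hbar) :
    HasRotation (attainable hbar) (0, 0) (1, 0) := by
  refine hasRotation_of_rotors (rotor_JI h) (rotor_JZ h) (ε := 1) (by simp) (by simp) ?_ ?_ ?_
  · simp [kronecker_mulVec_apply, pauliJ, pauliZ]
  · simp [kronecker_mulVec_apply, pauliJ, pauliZ]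
  · rintro ⟨a, b⟩
    fin_cases a <;> fin_cases b <;> simp [kronecker_mulVec_apply, pauliJ, pauliZ]

lemma hasRotation_01_11 {hbar : ℝ} (h : 0 < hbar) :
    HasRotation (attainable hbar) (0, 1) (1, 1) := by
  refine hasRotation_of_rotors (rotor_JI h) (rotor_JZ h) (ε := -1) (by simp) (by simp) ?_ ?_ ?_
  · simp [kronecker_mulVec_apply, pauliJ, pauliZ]
  · simp [kronecker_mulVec_apply, pauliJ, pauliZ]
  · rintro ⟨a, b⟩
    fin_cases a <;> fin_cases b <;> simp [kronecker_mulVec_apply, pauliJ, pauliZ]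

lemma hasRotation_00_01 {hbar : ℝ} (h : 0 < hbar) :
    HasRotation (attainable hbar) (0, 0) (0, 1) := by
  refine hasRotation_of_rotors (rotor_IJ h) (rotor_ZJ h) (ε := 1) (by simp) (by simp) ?_ ?_ ?_
  · simp [kronecker_mulVec_apply, pauliJ, pauliZ]
  · simp [kronecker_mulVec_apply, pauliJ, pauliZ]
  · rintro ⟨a, b⟩
    fin_cases a <;> fin_cases b <;> simp [kronecker_mulVec_apply, pauliJ, pauliZ]

lemma hasRotation_10_11 {hbar : ℝ} (h : 0 < hbar) :
    HasRotation (attainable hbar) (1, 0) (1, 1) := by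
  refine hasRotation_of_rotors (rotor_IJ h) (rotor_ZJ h) (ε := -1) (by simp) (by simp) ?_ ?_ ?_
  · simp [kronecker_mulVec_apply, pauliJ, pauliZ]
  · simp [kronecker_mulVec_apply, pauliJ, pauliZ]
  · rintro ⟨a, b⟩
    fin_cases a <;> fin_cases b <;> simp [kronecker_mulVec_apply, pauliJ, pauliZ]

/-- Both generators flip both bits; they agree when the bits are equal and are opposite when the
bits differ. -/
lemma hasRotation_00_11 {hbar : ℝ} (h : 0 < hbar) :
    HasRotation (attainable hbar) (0, 0) (1, 1) := by
  refine hasRotation_of_rotors (rotor_JX h) (rotor_XJ h) (ε := 1) (by simp) (by simp) ?_ ?_ ?_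
  · simp [kronecker_mulVec_apply, pauliJ, pauliX]
  · simp [kronecker_mulVec_apply, pauliJ, pauliX]
  · rintro ⟨a, b⟩
    fin_cases a <;> fin_cases b <;> simp [kronecker_mulVec_apply, pauliJ, pauliX]

lemma hasRotation_01_10 {hbar : ℝ} (h : 0 < hbar) :
    HasRotation (attainable hbar) (0, 1) (1, 0) := by
  refine hasRotation_of_rotors (rotor_JX h) (rotor_XJ h) (ε := -1) (by simp) (by simp) ?_ ?_ ?_
  · simp [kronecker_mulVec_apply, pauliJ, pauliX]
  · simp [kronecker_mulVec_apply, pauliJ, pauliX]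
  · rintro ⟨a, b⟩
    fin_cases a <;> fin_cases b <;> simp [kronecker_mulVec_apply, pauliJ, pauliX]

lemma hasRotations_attainable {hbar : ℝ} (h : 0 < hbar) : HasRotations (attainable hbar) := by
  rintro ⟨a, b⟩ ⟨c, d⟩ hne
  change HasRotation (attainable hbar) (a, b) (c, d)
  fin_cases a <;> fin_cases b <;> fin_cases c <;> fin_cases d
  · exact absurd rfl hne
  · exact hasRotation_00_01 h
  · exact hasRotation_00_10 h
  · exact hasRotation_00_11 h
  · exact (hasRotation_00_01 h).symm hne.symm
  · exact absurd rfl hne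
  · exact hasRotation_01_10 h
  · exact hasRotation_01_11 h
  · exact (hasRotation_00_10 h).symm hne.symm
  · exact (hasRotation_01_10 h).symm hne.symm
  · exact absurd rfl hne
  · exact hasRotation_10_11 h
  · exact (hasRotation_00_11 h).symm hne.symm
  · exact (hasRotation_01_11 h).symm hne.symm
  · exact (hasRotation_10_11 h).symm hne.symm
  · exact absurd rfl hne

lemma densityMatrixControllable_of_unitaryGroup_le {n : Type*} [Fintype n] [DecidableEq n] {m : ℕ}
    {hbar : ℝ} {H : (Fin m → ℝ) → Matrix n n ℂ} {hH : H 0 = 0}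
    (h : Matrix.unitaryGroup n ℂ ≤ steerable hbar H hH) : DensityMatrixControllable hbar H := by
  rintro ρi ρf - - ⟨U, hU, rfl⟩
  obtain ⟨T, u, ρ, hT, hu, hρ, h₀, h₁⟩ := h hU ρi
  exact ⟨T, u, ρ, hT, hu.continuousOn, fun t _ => HasDerivAt.hasDerivWithinAt (F := n → n → ℂ) (hρ t), (h₀ 0 le_rfl).2,
    (h₁ T le_rfl).2⟩

end QuantumControl

theorem mainTheorem1 (hbar : ℝ) (hbar_pos : 0 < hbar) :
    QuantumControl.DensityMatrixControllable hbar QuantumControl.twoQubitHamiltonian := by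
  have h := QuantumControl.unitaryGroup_le_of_phases_of_rotations
    (G := QuantumControl.attainable hbar) inf_le_right
    (QuantumControl.hasPhases_attainable hbar_pos) (QuantumControl.hasRotations_attainable hbar_pos)
  exact QuantumControl.densityMatrixControllable_of_unitaryGroup_le (h.trans inf_le_left)
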